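/- Fix a universal, additively optimal binary machine $U$: a partial computable function $(P,y)\mapsto U(P,y)$ on pairs of binary strings such that every program of every such machine $V$ is equivalent to some program of $U$, and such that for every $V$ there is a constant $c$ with: whenever $V(P,y)=x$, some $Q$ of length $l(Q)\le l(P)+c$ has $U(Q,y)=x$. Let $C(x\mid y)$ be the length of a shortest $P$ with $U(P,y)=x$, and $C(x)=C(x\mid\epsilon)$, with natural numbers identified with binary strings in the usual way ($0,1,2,3,\dots\leftrightarrow\epsilon,0,1,00,\dots$). For a real $\alpha$ let $\alpha_n$ be the string of the first $n$ binary digits of $\alpha$ (after the binary point), and let $C_{\beta,n}=C(C(\beta_n)\mid\beta_n)$. A real is left c.e. if it is the limit of a computable nondecreasing sequence of rationals; a program $P_\alpha$ for $\alpha$ is a program for $U$ that outputs the $s$-th term of such a sequence on input $s$. (1) There is a computable function $D:\mathbb N^2\to\mathbb N$ such that for all left c.e. reals $\alpha,\beta$ with programs $P_\alpha,P_\beta$ the following holds with $d=D(l(P_\alpha),l(P_\beta))$: if $C(\alpha_n\mid\beta_n)\le C_{\beta,n}+d$ for all $n$, then $\alpha$ is computable in $\beta$ (that is, the digit sequence of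 $\alpha$ is Turing reducible to that of $\beta$). (2) The hypothesis $C(\alpha_n\mid\beta_n)=O(1)$ of the Downey–Hirschfeldt–LaForte theorem can be weakened: for all left c.e. reals $\alpha,\beta$, if there is a constant $d\in\mathbb N$ with $C(\alpha_n\mid\beta_n)\le C_{\beta,n}+d$ for all $n$, then $\alpha$ is computable in $\beta$. -/

import Mathlib

/-- The Li–Vitányi identification of natural numbers with binary strings:
`0 ↦ ε, 1 ↦ 0, 2 ↦ 1, 3 ↦ 00, 4 ↦ 01, …` (the binary expansion of `n + 1` without its leading
`1`). -/
def natStr (n : ℕ) : List Bool := (Nat.bits (n + 1)).dropLast.reverse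

/-- `U p y` is the (possibly undefined) output of the machine on program `p` with side input `y`.
`U` is universal: every program of every machine is equivalent to some program of `U`. It is
additively optimal: compared with any other machine, it loses at most a constant in the length of
a shortest program. -/
structure IsUniversalOptimal (U : List Bool → List Bool →. List Bool) : Prop where
  partrec : Partrec₂ U
  universal : ∀ V : List Bool → List Bool →. List Bool, Partrec₂ V →
    ∀ p, ∃ q, ∀ y, U q y = V p y
  optimal : ∀ V : List Bool → List Bool →. List Bool, Partrec₂ V →
    ∃ c : ℕ, ∀ p y x, x ∈ V p y → ∃ q, x ∈ U q y ∧ q.length ≤ p.length + c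

/-- Conditional Kolmogorov complexity `C(x | y)` with respect to `U`. -/
noncomputable def condC (U : List Bool → List Bool →. List Bool) (x y : List Bool) : ℕ :=
  sInf {l | ∃ p : List Bool, x ∈ U p y ∧ p.length = l}

/-- Plain Kolmogorov complexity `C(x) = C(x | ε)`. -/
noncomputable def plainC (U : List Bool → List Bool →. List Bool) (x : List Bool) : ℕ :=
  condC U x []

/-- The `i`-th digit (counting from `0`) after the binary point of the real `α`. -/
noncomputable def binDigit (α : ℝ) (i : ℕ) : Bool := decide (⌊α * 2 ^ (i + 1)⌋ % 2 = 1)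

/-- `α_n`: the string of the first `n` binary digits of `α`. -/
noncomputable def initSeg (α : ℝ) (n : ℕ) : List Bool := (List.range n).map (binDigit α)

/-- `C_{β,n} = C(C(β_n) | β_n)`. -/
noncomputable def withheldC (U : List Bool → List Bool →. List Bool) (β : ℝ) (n : ℕ) : ℕ :=
  condC U (natStr (plainC U (initSeg β n))) (initSeg β n)

/-- A standard numbering of the rationals: `⟨⟨a, b⟩, c⟩ ↦ (a - b) / (c + 1)`. -/
def ratOfNat (m : ℕ) : ℚ :=
  ((m.unpair.1.unpair.1 : ℚ) - (m.unpair.1.unpair.2 : ℚ)) / ((m.unpair.2 : ℚ) + 1)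

/-- `f` lists (codes of) a nondecreasing sequence of rationals with limit `α`. -/
def ApproxFromBelow (f : ℕ → ℕ) (α : ℝ) : Prop :=
  Monotone (fun s => ratOfNat (f s)) ∧
    Filter.Tendsto (fun s => ((ratOfNat (f s) : ℚ) : ℝ)) Filter.atTop (nhds α)

/-- `α` is a left c.e. real: the limit of a computable nondecreasing sequence of rationals. -/
def IsLeftCE (α : ℝ) : Prop := ∃ f : ℕ → ℕ, Computable f ∧ ApproxFromBelow f α

/-- `P` is a program (for `U`) for the left c.e. real `α`: on input `s` it outputs the `s`-th term
of a nondecreasing sequence of rationals with limit `α`. -/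
def IsProgramFor (U : List Bool → List Bool →. List Bool) (P : List Bool) (α : ℝ) : Prop :=
  ∃ f : ℕ → ℕ, (∀ s, natStr (f s) ∈ U P (natStr s)) ∧ ApproxFromBelow f α

/-- `α` is computable in `β`: the binary digits of `α` are Turing reducible to those of `β`. -/
def ComputableFrom (α β : ℝ) : Prop :=
  TuringReducible (fun i => Part.some (binDigit α i).toNat) (fun i => Part.some (binDigit β i).toNat)

/-!
Approximate `α` and `β` from below. A stage after `s` at which the approximation to `α_n` changes
yields a guess at a prefix of `β`, namely the current approximation to the prefix of length
`2 ^ (j + 1)`, where `j` codes `(n, s)`.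

If infinitely many guesses are correct, then for those `j` every `β_n` with `n` in
`[2 ^ j, 2 ^ (j + 1))` can be computed from `n`. So `C(β_n) ≤ j + O(1)`, and since few strings
are simpler than `j`, the value `C(β_n)` is for most of these `n` known from `n` up to `O(1)`
alternatives: `C_{β,n}` is bounded. The hypothesis then makes `C(α_n | β_n)` bounded for more than
half of these `n`, so `α_j` is one of a bounded number of strings that win a majority vote over the
block. If `l` is the limit superior of the position of `α_j` among these popular strings, then
infinitely often the `l`-th of them to appear below an approximation to `α_j` certifies that the
approximation has reached `α_j`.

If only finitely many guesses are correct, then once `β` tells that its own approximation has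
settled on a sufficiently long prefix, the approximation to `α_n` can no longer change.
-/

section RecursivelyEnumerable

variable {γ δ : Type*} [Primcodable γ] [Primcodable δ]

theorem rePred_comp {p : δ → Prop} (hp : REPred p) {f : γ → δ} (hf : Computable f) :
    REPred fun a => p (f a) :=
  Partrec.comp hp hf

theorem rePred_eq {f g : γ → δ} (hf : Computable f) (hg : Computable g) :
    REPred fun a => f a = g a := by
  classical
  exact rePred_comp (p := fun a : δ × δ => a.1 = a.2) Primrec.eq.computablePred.to_re
    (hf.pair hg)

theorem rePred_le {f g : γ → ℕ} (hf : Computable f) (hg : Computable g) :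
    REPred fun a => f a ≤ g a :=
  rePred_comp (p := fun a : ℕ × ℕ => a.1 ≤ a.2) Primrec.nat_le.computablePred.to_re (hf.pair hg)

theorem rePred_and {p q : γ → Prop} (hp : REPred p) (hq : REPred q) :
    REPred fun a => p a ∧ q a :=
  (Partrec.bind hp (Partrec.comp hq Computable.fst).to₂).dom_re.of_eq fun a => by simp [Part.assert]

theorem rePred_exists_of_computable {q : γ → ℕ → Bool} (hq : Computable₂ q) :
    REPred fun a => ∃ n, q a n = true :=
  (Partrec.rfind hq.partrec₂).dom_re.of_eq fun a => by simp

theorem exists_stages_of_rePred {p : γ → Prop} (hp : REPred p) :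
    ∃ q : ℕ → γ → Bool, Computable₂ q ∧ (∀ a, Monotone fun s => q s a) ∧
      ∀ a, p a ↔ ∃ s, q s a = true := by
  obtain ⟨c, hc⟩ := Nat.Partrec.Code.exists_code.1 hp
  refine ⟨fun s a => (c.evaln s (Encodable.encode a)).isSome, ?_, ?_, fun a => ?_⟩
  · exact Primrec.option_isSome.to_comp.comp (Nat.Partrec.Code.primrec_evaln.to_comp.comp
      ((Computable.fst.pair (Computable.const c)).pair (Computable.encode.comp Computable.snd)))
  · refine fun a s t hst => Bool.le_iff_imp.2 fun h => ?_
    obtain ⟨v, hv⟩ := Option.isSome_iff_exists.1 h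
    exact Option.isSome_iff_exists.2 ⟨v, Nat.Partrec.Code.evaln_mono hst hv⟩
  · have halts : (c.eval (Encodable.encode a)).Dom ↔ p a := by rw [hc]; simp [Part.assert]
    simp only [← halts, Part.dom_iff_mem, Option.isSome_iff_exists,
      Nat.Partrec.Code.evaln_complete, Option.mem_def]
    exact exists_comm

theorem rePred_exists {p : γ → δ → Prop} (hp : REPred fun a : γ × δ => p a.1 a.2) :
    REPred fun a => ∃ b, p a b := by
  obtain ⟨q, hq, -, hpq⟩ := exists_stages_of_rePred hp
  let search (a : γ) (m : ℕ) : Bool :=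
    ((Encodable.decode (α := δ) m.unpair.1).map fun b => q m.unpair.2 (a, b)).getD false
  have computable_search : Computable₂ search := by
    have unpair_snd : Computable fun a : γ × ℕ => a.2.unpair :=
      Computable.unpair.comp Computable.snd
    refine Computable.option_getD (Computable.option_map
      (Computable.decode.comp (Computable.fst.comp unpair_snd)) ?_) (Computable.const false)
    exact hq.comp (Computable.snd.comp (unpair_snd.comp Computable.fst))
      ((Computable.fst.comp Computable.fst).pair Computable.snd)
  refine (rePred_exists_of_computable computable_search).of_eq fun a => ?_
  constructor
  · rintro ⟨m, hm⟩
    obtain ⟨b, -, hb⟩ : ∃ b, Encodable.decode m.unpair.1 = some b ∧ q m.unpair.2 (a, b) = true := by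
      simpa [search, Option.getD_eq_iff] using hm
    exact ⟨b, (hpq (a, b)).2 ⟨_, hb⟩⟩
  · rintro ⟨b, hb⟩
    obtain ⟨s, hs⟩ := (hpq (a, b)).1 hb
    exact ⟨Nat.pair (Encodable.encode b) s, by simpa [search] using hs⟩

theorem rePred_mem {f : γ →. δ} (hf : Partrec f) {g : γ → δ} (hg : Computable g) :
    REPred fun a => g a ∈ f a :=
  (Partrec.bind hf (Partrec.comp
    (rePred_eq (Computable.fst (α := δ) (β := δ)) Computable.snd)
    (Computable.snd.pair (hg.comp Computable.fst))).to₂).dom_re.of_eq fun a => by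
      simp [Part.mem_eq, Part.assert]

theorem computable_count {q : γ → ℕ → Bool} (hq : Computable₂ q) {N : γ → ℕ} (hN : Computable N) :
    Computable fun a => Nat.count (fun i => q a i = true) (N a) := by
  have step : Computable₂ fun (a : γ) (c : ℕ × ℕ) => c.2 + (q a c.1).toNat :=
    Primrec.nat_add.to_comp.comp (Computable.snd.comp Computable.snd)
      ((Primrec.dom_bool Bool.toNat).to_comp.comp
        (hq.comp Computable.fst (Computable.fst.comp Computable.snd)))
  refine (Computable.nat_rec hN (Computable.const 0) step).of_eq fun a => ?_
  induction N a with
  | zero => simp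
  | succ n ih => simp only [ih, Nat.count_succ]; cases q a n <;> simp

open scoped Classical in
theorem rePred_le_card_filter {p : γ → ℕ → Prop} (hp : REPred fun a : γ × ℕ => p a.1 a.2)
    {k N : γ → ℕ} (hk : Computable k) (hN : Computable N) :
    REPred fun a => k a ≤ ((Finset.range (N a)).filter (p a)).card := by
  obtain ⟨q, hq, hmono, hpq⟩ := exists_stages_of_rePred hp
  have computable_stageCount : Computable₂ fun (a : γ) (s : ℕ) =>
      Nat.count (fun i => q s (a, i) = true) (N a) :=
    computable_count (γ := γ × ℕ) (q := fun a i => q a.2 (a.1, i))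
      (hq.comp (Computable.snd.comp Computable.fst)
        ((Computable.fst.comp Computable.fst).pair Computable.snd)) (hN.comp Computable.fst)
  have rePred_reached : REPred fun a => ∃ s, k a ≤ Nat.count (fun i => q s (a, i) = true) (N a) :=
    rePred_exists (rePred_le (hk.comp Computable.fst) computable_stageCount)
  refine rePred_reached.of_eq fun a => ?_
  simp only [Nat.count_eq_card_filter_range]
  constructor
  · rintro ⟨s, hs⟩
    exact hs.trans (Finset.card_le_card
      (Finset.monotone_filter_right _ fun i _ hi => (hpq (a, i)).2 ⟨s, hi⟩))
  · intro h
    have settled : ∀ᶠ s in Filter.atTop, ∀ i ∈ Finset.range (N a), p a i → q s (a, i) = true := by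
      refine (Finset.eventually_all _).2 fun i _ => ?_
      by_cases hi : p a i
      · obtain ⟨s, hs⟩ := (hpq (a, i)).1 hi
        filter_upwards [Filter.eventually_ge_atTop s] with t hst _
        exact Bool.le_iff_imp.1 (hmono _ hst) hs
      · exact Filter.Eventually.of_forall fun s hpi => absurd hpi hi
    obtain ⟨s, hs⟩ := settled.exists
    exact ⟨s, h.trans (Finset.card_le_card fun i hi => Finset.mem_filter.2
      ⟨(Finset.mem_filter.1 hi).1, hs i (Finset.mem_filter.1 hi).1 (Finset.mem_filter.1 hi).2⟩)⟩

end RecursivelyEnumerable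

section Oracle

theorem recursiveIn_comp {O : Set (ℕ →. ℕ)} {f g : ℕ → ℕ}
    (hf : Nat.RecursiveIn O fun n => Part.some (f n))
    (hg : Nat.RecursiveIn O fun n => Part.some (g n)) :
    Nat.RecursiveIn O fun n => Part.some (f (g n)) :=
  (Nat.RecursiveIn.comp hf hg).of_eq fun n => by simp

theorem recursiveIn_pair {O : Set (ℕ →. ℕ)} {f g : ℕ → ℕ}
    (hf : Nat.RecursiveIn O fun n => Part.some (f n))
    (hg : Nat.RecursiveIn O fun n => Part.some (g n)) :
    Nat.RecursiveIn O fun n => Part.some (Nat.pair (f n) (g n)) :=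
  (Nat.RecursiveIn.pair hf hg).of_eq fun n => by simp [Seq.seq]

theorem recursiveIn_of_computable {O : Set (ℕ →. ℕ)} {f : ℕ → ℕ} (hf : Computable f) :
    Nat.RecursiveIn O fun n => Part.some (f n) :=
  RecursiveIn.iff_nat.1 hf.partrec.recursiveIn

theorem recursiveIn_of_search {O : Set (ℕ →. ℕ)} {p : ℕ → ℕ → Bool} {out f : ℕ → ℕ}
    (hp : Nat.RecursiveIn O fun m => Part.some (bif p m.unpair.1 m.unpair.2 then 0 else 1))
    (hout : Computable out) (sound : ∀ i k, p i k = true → out k = f i)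
    (complete : ∀ i, ∃ k, p i k = true) : Nat.RecursiveIn O fun i => Part.some (f i) := by
  have search : Nat.RecursiveIn O fun i => Nat.rfind (p i : ℕ →. Bool) :=
    (Nat.RecursiveIn.rfind hp).of_eq fun i => congrArg Nat.rfind <| funext fun k => by
      cases h : p i k <;> simp [h]
  refine Nat.RecursiveIn.of_eq_tot
    (Nat.RecursiveIn.comp (recursiveIn_of_computable hout) search) fun i => ?_
  obtain ⟨_, hk⟩ := complete i
  obtain ⟨k, hk, -⟩ := Nat.rfind_min' hk
  rw [← sound i k (Part.mem_some_iff.1 (Nat.rfind_spec hk)).symm]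
  exact Part.mem_bind hk (Part.mem_some _)

variable {f g : ℕ → Bool}

theorem recursiveIn_encode_prefix :
    Nat.RecursiveIn {fun i => Part.some (g i).toNat}
      fun n => Part.some (Encodable.encode ((List.range n).map g)) := by
  let append (m : ℕ) : ℕ := Encodable.encode
    (((Encodable.decode (α := List Bool) m.unpair.1).getD []) ++ [decide (m.unpair.2 = 1)])
  have computable_append : Computable append :=
    (Primrec.encode.comp (Primrec.list_concat.comp
      (Primrec.option_getD.comp (Primrec.decode.comp (Primrec.fst.comp Primrec.unpair))
        (Primrec.const []))
      (Primrec.eq.decide.comp (Primrec.snd.comp Primrec.unpair) (Primrec.const 1)))).to_comp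
  have unpair_snd : Computable fun m : ℕ => m.unpair.2.unpair :=
    Computable.unpair.comp (Computable.snd.comp Computable.unpair)
  have digit : Nat.RecursiveIn {fun i => Part.some (g i).toNat} fun i => Part.some (g i).toNat :=
    .oracle _ rfl
  have step := recursiveIn_comp (recursiveIn_of_computable computable_append)
    (recursiveIn_pair (recursiveIn_of_computable (Computable.snd.comp unpair_snd))
      (recursiveIn_comp digit (recursiveIn_of_computable (Computable.fst.comp unpair_snd))))
  have start : Computable fun n : ℕ => Nat.pair 0 n :=
    (Primrec₂.natPair.comp (Primrec.const 0) Primrec.id).to_comp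
  refine (Nat.RecursiveIn.comp (.prec .zero step) (recursiveIn_of_computable start)).of_eq
    fun n => ?_
  simp only [Part.bind_eq_bind, Part.bind_some, Nat.unpair_pair]
  induction n with
  | zero => rfl
  | succ n ih =>
    simp only [ih, Part.bind_some]
    simp only [append, Nat.unpair_pair, Encodable.encodek, Option.getD_some,
      List.range_succ, List.map_append, List.map_singleton]
    cases g n <;> rfl

theorem recursiveIn_of_prefix {F : ℕ → List Bool → ℕ} (hF : Computable₂ F) {u : ℕ → ℕ}
    (hu : Computable u) :
    Nat.RecursiveIn {fun i => Part.some (g i).toNat}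
      fun m => Part.some (F m ((List.range (u m)).map g)) := by
  have decoded : Computable fun m : ℕ =>
      F m.unpair.1 ((Encodable.decode (α := List Bool) m.unpair.2).getD []) :=
    hF.comp (Computable.fst.comp Computable.unpair)
      (Computable.option_getD (Computable.decode.comp (Computable.snd.comp Computable.unpair))
        (Computable.const []))
  refine (recursiveIn_comp (recursiveIn_of_computable decoded)
    (recursiveIn_pair (f := fun m => m) (recursiveIn_of_computable Computable.id)
      (recursiveIn_comp recursiveIn_encode_prefix (recursiveIn_of_computable hu)))).of_eq
    fun m => ?_
  simp

theorem turingReducible_of_rePred_prefix {R : ℕ → Bool → List Bool → Prop}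
    (hR : REPred fun a : ℕ × Bool × List Bool => R a.1 a.2.1 a.2.2)
    (sound : ∀ i b n, R i b ((List.range n).map g) → b = f i)
    (complete : ∀ i, ∃ b n, R i b ((List.range n).map g)) :
    TuringReducible (fun i => Part.some (f i).toNat) (fun i => Part.some (g i).toNat) := by
  obtain ⟨q, hq, -, hqR⟩ := exists_stages_of_rePred hR
  -- A candidate `k` codes the answer, the length of the prefix and the stage of the enumeration.
  let answer (k : ℕ) : Bool := decide (k.unpair.1 = 1)
  let verified (i k : ℕ) (y : List Bool) : Bool := q k.unpair.2.unpair.2 (i, answer k, y)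
  have computable_answer : Computable answer :=
    (Primrec.eq.decide.comp (Primrec.fst.comp Primrec.unpair) (Primrec.const 1)).to_comp
  have unpair_snd : Computable fun m : ℕ => m.unpair.2.unpair :=
    Computable.unpair.comp (Computable.snd.comp Computable.unpair)
  have unpair_fst : Computable fun a : ℕ × List Bool => a.1.unpair :=
    Computable.unpair.comp Computable.fst
  have test := recursiveIn_of_prefix (g := g)
    (F := fun m y => bif verified m.unpair.1 m.unpair.2 y then 0 else 1)
    (Computable.cond (hq.comp
        (Computable.snd.comp (unpair_snd.comp (Computable.snd.comp unpair_fst)))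
        ((Computable.fst.comp unpair_fst).pair
          ((computable_answer.comp (Computable.snd.comp unpair_fst)).pair Computable.snd)))
      (Computable.const 0) (Computable.const 1))
    (Computable.fst.comp (unpair_snd.comp (Computable.snd.comp Computable.unpair)))
  refine RecursiveIn.iff_nat.2 (recursiveIn_of_search
    (p := fun i k => verified i k ((List.range k.unpair.2.unpair.1).map g)) test
    ((Primrec.dom_bool Bool.toNat).to_comp.comp computable_answer) (fun i k hk => ?_) fun i => ?_)
  · exact congrArg Bool.toNat (sound i (answer k) _ ((hqR _).2 ⟨_, hk⟩))
  · obtain ⟨b, n, hbn⟩ := complete i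
    obtain ⟨s, hs⟩ := (hqR (i, b, (List.range n).map g)).1 hbn
    have answer_eq : answer (Nat.pair b.toNat (Nat.pair n s)) = b := by cases b <;> simp [answer]
    exact ⟨Nat.pair b.toNat (Nat.pair n s), by simpa [verified, answer_eq] using hs⟩

end Oracle

section Strings

theorem computable_of_rightInverse {γ δ : Type*} [Primcodable γ] [Primcodable δ] {f : γ → δ}
    {g : δ → γ} (hf : Computable f) (hinj : Function.Injective f) (h : Function.RightInverse g f) :
    Computable g := by
  classical
  let candidate (b : δ) (n : ℕ) : Option γ :=
    (Encodable.decode n).bind fun a => bif decide (f a = b) then some a else none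
  have computable_candidate : Computable₂ candidate :=
    Computable.option_bind (Computable.decode.comp Computable.snd)
      (Computable.cond (Primrec.eq.decide.to_comp.comp (hf.comp Computable.snd)
        (Computable.fst.comp Computable.fst)) (Computable.option_some.comp Computable.snd)
        (Computable.const none))
  refine (Partrec.rfindOpt computable_candidate).of_eq_tot fun b => ?_
  obtain ⟨a, ha⟩ := Part.dom_iff_mem.1 (Nat.rfindOpt_dom.2 ⟨Encodable.encode (g b), g b,
    show g b ∈ candidate b _ by simp [candidate, h b]⟩)
  obtain ⟨n, hn⟩ := Nat.rfindOpt_spec ha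
  obtain ⟨a', -, ha'⟩ := Option.mem_bind_iff.1 hn
  have : f a = b := by
    by_cases hb : f a' = b
    · simp_all
    · simp [hb] at ha'
  rwa [← hinj (this.trans (h b).symm)]

/-- The inverse of `natStr`: the successor of `strNat p` has a `1` followed by `p` as its binary
expansion. -/
def strNat (p : List Bool) : ℕ := p.foldl (fun a b => 2 * a + 1 + b.toNat) 0

theorem strNat_concat (p : List Bool) (b : Bool) :
    strNat (p ++ [b]) = 2 * strNat p + 1 + b.toNat := by simp [strNat]

theorem strNat_natStr (n : ℕ) : strNat (natStr n) = n := by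
  have decode_bits (m : ℕ) (hm : m ≠ 0) : strNat m.bits.dropLast.reverse + 1 = m := by
    induction m using Nat.binaryRec with
    | zero => exact absurd rfl hm
    | bit b m ih =>
      rcases eq_or_ne m 0 with rfl | hm₀
      · cases b
        · simp at hm
        · rfl
      · have bits_ne_nil : m.bits ≠ [] := fun h =>
          hm₀ (Nat.size_eq_zero.1 (by rw [← Nat.size_eq_bits_len, h]; rfl))
        rw [Nat.bits_append_bit m b (fun h => absurd h hm₀), List.dropLast_cons_of_ne_nil
          bits_ne_nil, List.reverse_cons, strNat_concat, Nat.bit_val]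
        have := ih hm₀
        omega
  exact Nat.succ_injective (decode_bits (n + 1) n.succ_ne_zero)

theorem strNat_injective : Function.Injective strNat := by
  intro p
  induction p using List.reverseRecOn with
  | nil =>
    intro q h
    cases q using List.reverseRecOn with
    | nil => rfl
    | append_singleton q c => rw [strNat_concat] at h; simp [strNat] at h; omega
  | append_singleton p b ih =>
    intro q h
    cases q using List.reverseRecOn with
    | nil => rw [strNat_concat] at h; simp [strNat] at h
    | append_singleton q c =>
      rw [strNat_concat, strNat_concat] at h
      have hb := Bool.toNat_le b
      have hc := Bool.toNat_le c
      have hbc : b.toNat = c.toNat := by omega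
      rw [ih (show strNat p = strNat q by omega)]
      cases b <;> cases c <;> simp_all

theorem natStr_strNat (p : List Bool) : natStr (strNat p) = p :=
  strNat_injective (strNat_natStr _)

theorem log_strNat_add_one (p : List Bool) : Nat.log 2 (strNat p + 1) = p.length := by
  suffices 2 ^ p.length ≤ strNat p + 1 ∧ strNat p + 1 < 2 ^ (p.length + 1) from
    Nat.log_eq_of_pow_le_of_lt_pow this.1 this.2
  induction p using List.reverseRecOn with
  | nil => simp [strNat]
  | append_singleton p b ih =>
    rw [strNat_concat, List.length_append, List.length_singleton, pow_succ, pow_succ _ (_ + 1)]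
    have := Bool.toNat_le b
    omega

theorem length_natStr (n : ℕ) : (natStr n).length = Nat.log 2 (n + 1) := by
  rw [← log_strNat_add_one, strNat_natStr]

theorem computable_strNat : Computable strNat := by
  have step : Primrec₂ fun (_ : List Bool) (x : ℕ × Bool) => 2 * x.1 + 1 + x.2.toNat :=
    Primrec.nat_add.comp (Primrec.succ.comp (Primrec.nat_mul.comp (Primrec.const 2)
      (Primrec.fst.comp Primrec.snd))) ((Primrec.dom_bool Bool.toNat).comp
        (Primrec.snd.comp Primrec.snd))
  exact (Primrec.list_foldl Primrec.id (Primrec.const 0) step).to_comp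

theorem computable_natStr : Computable natStr :=
  computable_of_rightInverse computable_strNat strNat_injective strNat_natStr

theorem primrec_two_pow : Primrec fun n : ℕ => 2 ^ n :=
  (Primrec₂.unpaired'.1 Nat.Primrec.pow).comp (Primrec.const 2) Primrec.id

end Strings

section Digits

theorem length_initSeg (α : ℝ) (n : ℕ) : (initSeg α n).length = n := by simp [initSeg]

theorem initSeg_succ (α : ℝ) (n : ℕ) : initSeg α (n + 1) = initSeg α n ++ [binDigit α n] := by
  simp [initSeg, List.range_succ]

theorem take_initSeg (α : ℝ) {n m : ℕ} (h : n ≤ m) : (initSeg α m).take n = initSeg α n := by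
  rw [initSeg, ← List.map_take, List.take_range, min_eq_left h, initSeg]

theorem floor_mul_two_pow_succ (α : ℝ) (n : ℕ) :
    ⌊α * 2 ^ (n + 1)⌋ = 2 * ⌊α * 2 ^ n⌋ + (binDigit α n).toNat := by
  have half : ⌊α * 2 ^ (n + 1)⌋ / 2 = ⌊α * 2 ^ n⌋ := by
    have := Int.floor_div_natCast (α * 2 ^ (n + 1)) 2
    rw [← Nat.cast_ofNat (R := ℤ), ← this, pow_succ]
    push_cast
    congr 1
    ring
  have digit : ((binDigit α n).toNat : ℤ) = ⌊α * 2 ^ (n + 1)⌋ % 2 := by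
    rcases Int.emod_two_eq_zero_or_one ⌊α * 2 ^ (n + 1)⌋ with h | h <;> simp [binDigit, h]
  omega

theorem strNat_initSeg (α : ℝ) (n : ℕ) :
    (strNat (initSeg α n) : ℤ) = ⌊α * 2 ^ n⌋ - ⌊α⌋ * 2 ^ n + (2 ^ n - 1) := by
  induction n with
  | zero => simp [initSeg, strNat]
  | succ n ih =>
    rw [initSeg_succ, strNat_concat, floor_mul_two_pow_succ, pow_succ]
    push_cast
    linarith

theorem initSeg_congr {α β : ℝ} {n : ℕ} (h₀ : ⌊α⌋ = ⌊β⌋) (h : ⌊α * 2 ^ n⌋ = ⌊β * 2 ^ n⌋) :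
    initSeg α n = initSeg β n :=
  strNat_injective (by zify; rw [strNat_initSeg, strNat_initSeg, h₀, h])

theorem binDigit_ratOfNat (m i : ℕ) :
    binDigit (ratOfNat m) i = decide ((m.unpair.1.unpair.1 + m.unpair.1.unpair.2 * m.unpair.2) *
      2 ^ (i + 1) / (m.unpair.2 + 1) % 2 = 1) := by
  set a := m.unpair.1.unpair.1
  set b := m.unpair.1.unpair.2
  set c := m.unpair.2
  have floor_add : ⌊(ratOfNat m : ℝ) * 2 ^ (i + 1)⌋ + 2 * (b * 2 ^ i) =
      ((a + b * c) * 2 ^ (i + 1) / (c + 1) : ℕ) := by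
    have shift : (ratOfNat m : ℝ) * 2 ^ (i + 1) + ((2 * (b * 2 ^ i) : ℤ) : ℝ) =
        (((a + b * c) * 2 ^ (i + 1) : ℕ) : ℝ) / ((c + 1 : ℕ) : ℝ) := by
      simp only [ratOfNat, a, b, c]
      push_cast
      field_simp
      ring
    rw [← Int.floor_add_intCast, shift, ← Nat.floor_div_eq_div (K := ℝ),
      Int.natCast_floor_eq_floor (by positivity)]
  rw [binDigit, decide_eq_decide]
  omega

theorem computable_initSeg_ratOfNat : Computable₂ fun m n => initSeg (ratOfNat m) n := by
  have unpair₁ : Primrec fun x : ℕ × ℕ => x.1.unpair := Primrec.unpair.comp Primrec.fst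
  have unpair₂ : Primrec fun x : ℕ × ℕ => x.1.unpair.1.unpair :=
    Primrec.unpair.comp (Primrec.fst.comp unpair₁)
  have den : Primrec fun x : ℕ × ℕ => x.1.unpair.2 := Primrec.snd.comp unpair₁
  have digit : Primrec₂ fun m i => binDigit (ratOfNat m) i := by
    refine Primrec.of_eq (f := fun x : ℕ × ℕ => decide (_ % 2 = 1)) ?_
      fun x => (binDigit_ratOfNat x.1 x.2).symm
    exact Primrec.eq.decide.comp (Primrec.nat_mod.comp (Primrec.nat_div.comp
      (Primrec.nat_mul.comp (Primrec.nat_add.comp (Primrec.fst.comp unpair₂)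
        (Primrec.nat_mul.comp (Primrec.snd.comp unpair₂) den)) (primrec_two_pow.comp
          (Primrec.succ.comp Primrec.snd)))
      (Primrec.succ.comp den)) (Primrec.const 2)) (Primrec.const 1)
  exact (Primrec.list_map (Primrec.list_range.comp Primrec.snd)
    (digit.comp (Primrec.fst.comp Primrec.fst) Primrec.snd).to₂).to_comp

end Digits

section LeftApproximations

/-- `A s n` is a computable stagewise approximation to the first `n` binary digits of `α`, from
below in the order of the numbers these strings stand for. -/
structure IsLeftApprox (A : ℕ → ℕ → List Bool) (α : ℝ) : Prop where
  computable : Computable₂ A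
  mono : ∀ n, Monotone fun s => strNat (A s n)
  eventually_eq : ∀ n, ∀ᶠ s in Filter.atTop, A s n = initSeg α n

namespace IsLeftApprox

variable {A : ℕ → ℕ → List Bool} {α : ℝ}

theorem le (hA : IsLeftApprox A α) (s n : ℕ) : strNat (A s n) ≤ strNat (initSeg α n) := by
  obtain ⟨t, ht, hst⟩ := ((hA.eventually_eq n).and (Filter.eventually_ge_atTop s)).exists
  exact ht ▸ hA.mono n hst

theorem eq_of_le (hA : IsLeftApprox A α) {s t n : ℕ} (hs : A s n = initSeg α n) (hst : s ≤ t) :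
    A t n = initSeg α n :=
  strNat_injective (le_antisymm (hA.le t n) (hs ▸ hA.mono n hst))

end IsLeftApprox

theorem ratOfNat_surjective : Function.Surjective ratOfNat := by
  intro q
  refine ⟨Nat.pair (Nat.pair q.num.toNat (-q.num).toNat) (q.den - 1), ?_⟩
  have num : (q.num.toNat : ℚ) - (-q.num).toNat = q.num := by
    exact_mod_cast Int.toNat_sub_toNat_neg q.num
  simp only [ratOfNat, Nat.unpair_pair, num, Nat.cast_pred q.den_pos, sub_add_cancel,
    Rat.num_div_den]

namespace IsLeftCE

variable {α : ℝ}

theorem exists_eventually_floor_eq (hα : IsLeftCE α) :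
    ∃ f : ℕ → ℕ, Computable f ∧ Monotone (fun s => ratOfNat (f s)) ∧
      ∀ n : ℕ, ∀ᶠ s in Filter.atTop, ⌊(ratOfNat (f s) : ℝ) * 2 ^ n⌋ = ⌊α * 2 ^ n⌋ := by
  by_cases hrat : ∃ q : ℚ, (q : ℝ) = α
  · obtain ⟨q, rfl⟩ := hrat
    obtain ⟨m, rfl⟩ := ratOfNat_surjective q
    exact ⟨fun _ => m, Computable.const m, monotone_const, fun n => .of_forall fun _ => rfl⟩
  obtain ⟨f, hf, hmono, hlim⟩ := hα
  refine ⟨f, hf, hmono, fun n => ?_⟩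
  have floor_lt : (⌊α * 2 ^ n⌋ : ℝ) / 2 ^ n < α := by
    refine lt_of_le_of_ne ((div_le_iff₀ (by positivity)).2 (Int.floor_le _)) fun h => hrat ?_
    exact ⟨⌊α * 2 ^ n⌋ / 2 ^ n, by push_cast; exact h⟩
  filter_upwards [hlim.eventually (lt_mem_nhds floor_lt)] with s hs
  have le_lim : (ratOfNat (f s) : ℝ) ≤ α :=
    Monotone.ge_of_tendsto (fun a b hab => by exact_mod_cast hmono hab) hlim s
  exact le_antisymm (by gcongr) (Int.le_floor.2 ((div_lt_iff₀ (by positivity)).1 hs).le)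

theorem exists_isLeftApprox (hα : IsLeftCE α) : ∃ A, IsLeftApprox A α := by
  obtain ⟨f, hf, hmono, hfloor⟩ := hα.exists_eventually_floor_eq
  obtain ⟨s₀, hs₀⟩ := Filter.eventually_atTop.1 (hfloor 0)
  have floor_eq (s : ℕ) : ⌊(ratOfNat (f (s + s₀)) : ℝ)⌋ = ⌊α⌋ := by
    simpa using hs₀ (s + s₀) (Nat.le_add_left _ _)
  refine ⟨fun s n => initSeg (ratOfNat (f (s + s₀))) n, ?_, fun n s t hst => ?_, fun n => ?_⟩
  · exact computable_initSeg_ratOfNat.comp (hf.comp (Primrec.nat_add.to_comp.comp Computable.fst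
      (Computable.const s₀))) Computable.snd
  · have le : (ratOfNat (f (s + s₀)) : ℝ) ≤ ratOfNat (f (t + s₀)) := by
      exact_mod_cast hmono (Nat.add_le_add_right hst s₀)
    have floor_le : ⌊(ratOfNat (f (s + s₀)) : ℝ) * 2 ^ n⌋ ≤ ⌊(ratOfNat (f (t + s₀)) : ℝ) * 2 ^ n⌋ :=
      by gcongr
    zify
    rw [strNat_initSeg, strNat_initSeg, floor_eq, floor_eq]
    linarith
  · filter_upwards [(Filter.tendsto_add_atTop_nat s₀).eventually (hfloor n)] with s hs
    exact initSeg_congr (floor_eq s) hs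

end IsLeftCE

theorem IsProgramFor.isLeftCE {U : List Bool → List Bool →. List Bool} (hU : Partrec₂ U)
    {P : List Bool} {α : ℝ} (h : IsProgramFor U P α) : IsLeftCE α := by
  obtain ⟨f, hf, hα⟩ := h
  have run : Partrec fun s : ℕ => (U P (natStr s)).map strNat :=
    (hU.comp (Computable.const P) computable_natStr).map
      (computable_strNat.comp Computable.snd).to₂
  exact ⟨f, run.of_eq_tot fun s => (Part.mem_map_iff _).2 ⟨_, hf s, strNat_natStr _⟩, hα⟩

end LeftApproximations

section Complexity

/-- Compared with any other machine, `U` loses at most a constant in the length of a shortest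
program. -/
def IsAdditivelyOptimal (U : List Bool → List Bool →. List Bool) : Prop :=
  ∀ V : List Bool → List Bool →. List Bool, Partrec₂ V →
    ∃ c : ℕ, ∀ p y x, x ∈ V p y → ∃ q, x ∈ U q y ∧ q.length ≤ p.length + c

/-- The block `[2 ^ j, 2 ^ (j + 1))` of `2 ^ j` consecutive lengths. -/
def dyadicBlock (j : ℕ) : Finset ℕ := Finset.Ico (2 ^ j) (2 ^ (j + 1))

theorem card_dyadicBlock (j : ℕ) : (dyadicBlock j).card = 2 ^ j := by
  rw [dyadicBlock, Nat.card_Ico, pow_succ]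
  omega

theorem log_of_mem_dyadicBlock {j n : ℕ} (hn : n ∈ dyadicBlock j) : Nat.log 2 n = j :=
  Nat.log_eq_of_pow_le_of_lt_pow (Finset.mem_Ico.1 hn).1 (Finset.mem_Ico.1 hn).2

theorem length_natStr_pred_of_mem_dyadicBlock {j n : ℕ} (hn : n ∈ dyadicBlock j) :
    (natStr (n - 1)).length = j := by
  have := (Nat.two_pow_pos j).trans_le (Finset.mem_Ico.1 hn).1
  rw [length_natStr, Nat.sub_add_cancel this, log_of_mem_dyadicBlock hn]

theorem condC_le_length {U : List Bool → List Bool →. List Bool} {p y x : List Bool}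
    (h : x ∈ U p y) : condC U x y ≤ p.length :=
  Nat.sInf_le ⟨p, h, rfl⟩

namespace IsAdditivelyOptimal

variable {U : List Bool → List Bool →. List Bool} (hU : IsAdditivelyOptimal U)
include hU

theorem exists_condC_le {V : List Bool → List Bool →. List Bool} (hV : Partrec₂ V) :
    ∃ c : ℕ, ∀ p y x, x ∈ V p y → condC U x y ≤ p.length + c := by
  obtain ⟨c, hc⟩ := hU V hV
  refine ⟨c, fun p y x hx => ?_⟩
  obtain ⟨q, hq, hlen⟩ := hc p y x hx
  exact (condC_le_length hq).trans hlen

theorem exists_shortest_program (x y : List Bool) : ∃ p, x ∈ U p y ∧ p.length = condC U x y := by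
  obtain ⟨c, hc⟩ := hU (fun p _ => Part.some p) Computable.fst.partrec
  obtain ⟨q, hq, -⟩ := hc x y x (Part.mem_some x)
  exact Nat.sInf_mem (s := {l | ∃ p : List Bool, x ∈ U p y ∧ p.length = l}) ⟨_, q, hq, rfl⟩

theorem condC_le_iff {x y : List Bool} {e : ℕ} :
    condC U x y ≤ e ↔ ∃ p, p.length ≤ e ∧ x ∈ U p y := by
  constructor
  · obtain ⟨p, hp, hlen⟩ := hU.exists_shortest_program x y
    exact fun h => ⟨p, hlen.trans_le h, hp⟩
  · rintro ⟨p, hlen, hp⟩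
    exact (condC_le_length hp).trans hlen

theorem rePred_condC_le (hU' : Partrec₂ U) (e : ℕ) :
    REPred fun a : List Bool × List Bool => condC U a.1 a.2 ≤ e :=
  (rePred_exists (p := fun a (p : List Bool) => p.length ≤ e ∧ a.1 ∈ U p a.2) (rePred_and
    (rePred_le (Primrec.list_length.to_comp.comp Computable.snd) (Computable.const e))
    (rePred_mem (hU'.comp Computable.snd (Computable.snd.comp Computable.fst))
      (Computable.fst.comp Computable.fst)))).of_eq fun _ => hU.condC_le_iff.symm

theorem card_lt_two_pow {ι : Type*} {s : Finset ι} {x : ι → List Bool} (hx : Set.InjOn x s)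
    {y : List Bool} {k : ℕ} (h : ∀ i ∈ s, condC U (x i) y < k) : s.card < 2 ^ k := by
  choose p hp hlen using fun i => hU.exists_shortest_program (x i) y
  have code_lt (i : ι) (hi : i ∈ s) : strNat (p i) + 1 < 2 ^ k := by
    rw [← Nat.log_lt_iff_lt_pow one_lt_two (Nat.succ_ne_zero _), log_strNat_add_one, hlen]
    exact h i hi
  have code_injOn : Set.InjOn (fun i => strNat (p i)) s := fun i hi i' hi' hii' =>
    hx hi hi' (Part.mem_unique (hp i) (strNat_injective hii' ▸ hp i'))
  have := Finset.card_le_card_of_injOn (t := Finset.range (2 ^ k - 1)) _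
    (fun i hi => Finset.mem_coe.2 (Finset.mem_range.2 (Nat.lt_sub_of_add_lt (code_lt i hi))))
    code_injOn
  rw [Finset.card_range] at this
  have := Nat.two_pow_pos k
  omega

theorem exists_condC_natStr_add_le {h : List Bool → ℕ} (hh : Computable h) :
    ∃ c, ∀ y e, condC U (natStr (h y + e)) y ≤ e + c := by
  let V (p y : List Bool) : List Bool := natStr (h y + p.length)
  have computable_V : Computable₂ V :=
    computable_natStr.comp (Primrec.nat_add.to_comp.comp (hh.comp Computable.snd)
      (Primrec.list_length.to_comp.comp Computable.fst))
  obtain ⟨c, hc⟩ := hU.exists_condC_le computable_V.partrec₂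
  refine ⟨c, fun y e => ?_⟩
  simpa [V] using hc (List.replicate e false) y _ (Part.mem_some _)

theorem exists_plainC_take_le {g : ℕ →. List Bool} (hg : Partrec g) :
    ∃ c, ∀ j, ∀ y ∈ g j, ∀ n ∈ dyadicBlock j, plainC U (y.take n) ≤ j + c := by
  let V (p _y : List Bool) : Part (List Bool) :=
    (g p.length).map fun x => x.take (strNat p + 1)
  have partrec_V : Partrec₂ V :=
    (hg.comp (Primrec.list_length.to_comp.comp Computable.fst)).map
      (Primrec.list_take.to_comp.comp (Computable.succ.comp
        (computable_strNat.comp (Computable.fst.comp Computable.fst))) Computable.snd).to₂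
  obtain ⟨c, hc⟩ := hU.exists_condC_le partrec_V
  refine ⟨c, fun j y hy n hn => ?_⟩
  have hlen := length_natStr_pred_of_mem_dyadicBlock hn
  have hpos : 1 ≤ n := Nat.one_le_two_pow.trans (Finset.mem_Ico.1 hn).1
  have output : y.take n ∈ V (natStr (n - 1)) [] := by
    refine (Part.mem_map_iff _).2 ⟨y, hlen.symm ▸ hy, ?_⟩
    rw [strNat_natStr, Nat.sub_add_cancel hpos]
  exact hlen ▸ hc _ _ _ output

theorem two_mul_card_plainC_lt_lt (β : ℝ) (j : ℕ) :
    2 * {n ∈ dyadicBlock j | plainC U (initSeg β n) < j - 1}.card < 2 ^ j := by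
  have card_lt : {n ∈ dyadicBlock j | plainC U (initSeg β n) < j - 1}.card < 2 ^ (j - 1) := by
    refine hU.card_lt_two_pow (x := initSeg β) (fun m _ n _ hmn => ?_)
      fun n hn => (Finset.mem_filter.1 hn).2
    simpa only [length_initSeg] using congrArg List.length hmn
  cases j with
  | zero => simp
  | succ j => rw [pow_succ]; simp only [Nat.add_sub_cancel] at card_lt ⊢; omega

theorem exists_two_pow_lt_two_mul_card_withheldC_le {g : ℕ →. List Bool} (hg : Partrec g) :
    ∃ c, ∀ (β : ℝ) (j : ℕ), initSeg β (2 ^ (j + 1)) ∈ g j →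
      2 ^ j < 2 * {n ∈ dyadicBlock j | withheldC U β n ≤ c}.card := by
  obtain ⟨c₁, hc₁⟩ := hU.exists_plainC_take_le hg
  let level (y : List Bool) : ℕ := (natStr (y.length - 1)).length - 1
  have computable_level : Computable level := by
    have pred {f : List Bool → ℕ} (hf : Computable f) : Computable fun y => f y - 1 :=
      Primrec.nat_sub.to_comp.comp hf (Computable.const 1)
    exact pred (Primrec.list_length.to_comp.comp
      (computable_natStr.comp (pred Primrec.list_length.to_comp)))
  obtain ⟨c₂, hc₂⟩ := hU.exists_condC_natStr_add_le computable_level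
  refine ⟨c₁ + 1 + c₂, fun β j hj => ?_⟩
  have withheldC_le (n : ℕ) (hn : n ∈ dyadicBlock j) (hlow : j - 1 ≤ plainC U (initSeg β n)) :
      withheldC U β n ≤ c₁ + 1 + c₂ := by
    have upper : plainC U (initSeg β n) ≤ j + c₁ := by
      simpa only [take_initSeg β (Finset.mem_Ico.1 hn).2.le] using hc₁ j _ hj n hn
    have level_eq : level (initSeg β n) = j - 1 := by
      simp only [level, length_initSeg, length_natStr_pred_of_mem_dyadicBlock hn]
    have := hc₂ (initSeg β n) (plainC U (initSeg β n) - (j - 1))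
    rw [level_eq, Nat.add_sub_cancel' hlow] at this
    rw [withheldC]
    omega
  have split := Finset.card_filter_add_card_filter_not (s := dyadicBlock j)
    fun n => plainC U (initSeg β n) < j - 1
  have few_low := hU.two_mul_card_plainC_lt_lt β j
  have high_le : {n ∈ dyadicBlock j | ¬ plainC U (initSeg β n) < j - 1}.card ≤
      {n ∈ dyadicBlock j | withheldC U β n ≤ c₁ + 1 + c₂}.card :=
    Finset.card_le_card fun n hn => by
      obtain ⟨hn, hlow⟩ := Finset.mem_filter.1 hn
      exact Finset.mem_filter.2 ⟨hn, withheldC_le n hn (not_lt.1 hlow)⟩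
  rw [card_dyadicBlock] at split
  omega

end IsAdditivelyOptimal

end Complexity

section PopularStrings

variable {U : List Bool → List Bool →. List Bool}

/-- Some extension of the `j`-bit string `x` has complexity at most `e` given the first `n` bits
of `y`. -/
def IsDescribed (U : List Bool → List Bool →. List Bool) (e j n : ℕ) (y x : List Bool) : Prop :=
  ∃ z, condC U z (y.take n) ≤ e ∧ z.take j = x

open scoped Classical in
/-- More than half of the prefixes of `y` with length in the `j`-th dyadic block describe `x`: a
majority vote that an initial segment of `α` wins when `y` is an initial segment of `β`. -/
def IsPopular (U : List Bool → List Bool →. List Bool) (e j : ℕ) (y x : List Bool) : Prop :=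
  2 ^ j < 2 * {n ∈ dyadicBlock j | IsDescribed U e j n y x}.card

open scoped Classical in
theorem IsAdditivelyOptimal.card_isPopular_le (hU : IsAdditivelyOptimal U) {e j : ℕ}
    {y : List Bool} {X : Finset (List Bool)} (hX : ∀ x ∈ X, IsPopular U e j y x) :
    X.card ≤ 2 ^ (e + 2) := by
  let r (x : List Bool) (n : ℕ) : Prop := IsDescribed U e j n y x
  have many_lengths (x : List Bool) (hx : x ∈ X) :
      2 ^ (j - 1) ≤ ((dyadicBlock j).bipartiteAbove r x).card := by
    have : 2 ^ j < 2 * ((dyadicBlock j).bipartiteAbove r x).card := hX x hx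
    cases j with
    | zero => rw [pow_zero] at this ⊢; omega
    | succ j => rw [pow_succ] at this; simp only [Nat.add_sub_cancel]; omega
  have few_strings (n : ℕ) (_ : n ∈ dyadicBlock j) :
      (X.bipartiteBelow r n).card ≤ 2 ^ (e + 1) := by
    have described (x : List Bool) : ∃ z, x ∈ X.bipartiteBelow r n →
        condC U z (y.take n) < e + 1 ∧ z.take j = x := by
      by_cases hx : x ∈ X.bipartiteBelow r n
      · obtain ⟨z, hz, hzx⟩ := (Finset.mem_filter.1 hx).2
        exact ⟨z, fun _ => ⟨Nat.lt_succ_of_le hz, hzx⟩⟩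
      · exact ⟨[], fun h => absurd h hx⟩
    choose z hz using described
    refine (hU.card_lt_two_pow (x := z) (fun x hx x' hx' h => ?_) fun x hx => (hz x hx).1).le
    rw [← (hz x hx).2, ← (hz x' hx').2, h]
  have double_count := Finset.card_mul_le_card_mul r many_lengths few_strings
  rw [card_dyadicBlock] at double_count
  refine Nat.le_of_mul_le_mul_right (double_count.trans ?_) (Nat.two_pow_pos (j - 1))
  rw [← pow_add, ← pow_add]
  exact Nat.pow_le_pow_right two_pos (by omega)

theorem IsAdditivelyOptimal.rePred_isDescribed (hU : IsAdditivelyOptimal U) (hU' : Partrec₂ U)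
    (e : ℕ) {γ : Type*} [Primcodable γ] {j n : γ → ℕ} {y x : γ → List Bool} (hj : Computable j)
    (hn : Computable n) (hy : Computable y) (hx : Computable x) :
    REPred fun a => IsDescribed U e (j a) (n a) (y a) (x a) := by
  have take : Computable₂ (List.take : ℕ → List Bool → List Bool) := Primrec.list_take.to_comp
  have simple : REPred fun b : γ × List Bool => condC U b.2 ((y b.1).take (n b.1)) ≤ e :=
    rePred_comp (hU.rePred_condC_le hU' e)
      (Computable.snd.pair (take.comp (hn.comp Computable.fst) (hy.comp Computable.fst)))
  have extends_x : REPred fun b : γ × List Bool => b.2.take (j b.1) = x b.1 :=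
    rePred_eq (take.comp (hj.comp Computable.fst) Computable.snd) (hx.comp Computable.fst)
  exact rePred_exists (p := fun a z => condC U z ((y a).take (n a)) ≤ e ∧ z.take (j a) = x a)
    (rePred_and simple extends_x)

open scoped Classical in
theorem IsAdditivelyOptimal.rePred_isPopular (hU : IsAdditivelyOptimal U) (hU' : Partrec₂ U)
    (e : ℕ) : REPred fun a : ℕ × List Bool × List Bool => IsPopular U e a.1 a.2.1 a.2.2 := by
  have two_pow_fst : Computable fun a : ℕ × List Bool × List Bool => 2 ^ a.1 :=
    primrec_two_pow.to_comp.comp Computable.fst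
  have rePred_counted := rePred_le_card_filter
    (p := fun (a : ℕ × List Bool × List Bool) n =>
      2 ^ a.1 ≤ n ∧ IsDescribed U e a.1 n a.2.1 a.2.2)
    (rePred_and (rePred_le (two_pow_fst.comp Computable.fst) Computable.snd)
      (hU.rePred_isDescribed hU' e (Computable.fst.comp Computable.fst) Computable.snd
        (Computable.fst.comp (Computable.snd.comp Computable.fst))
        (Computable.snd.comp (Computable.snd.comp Computable.fst))))
    (k := fun a => 2 ^ a.1 / 2 + 1) (N := fun a => 2 ^ (a.1 + 1))
    (Computable.succ.comp (Primrec.nat_div.to_comp.comp two_pow_fst (Computable.const 2)))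
    (primrec_two_pow.to_comp.comp (Computable.succ.comp Computable.fst))
  refine rePred_counted.of_eq fun a => ?_
  have filter_eq :
      {n ∈ Finset.range (2 ^ (a.1 + 1)) | 2 ^ a.1 ≤ n ∧ IsDescribed U e a.1 n a.2.1 a.2.2} =
        {n ∈ dyadicBlock a.1 | IsDescribed U e a.1 n a.2.1 a.2.2} := by
    ext n
    simp only [dyadicBlock, Finset.mem_filter, Finset.mem_Ico, Finset.mem_range]
    tauto
  rw [IsPopular, ← filter_eq, Nat.add_one_le_iff, Nat.div_lt_iff_lt_mul two_pos, mul_comm]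
  convert Iff.rfl

open scoped Classical in
theorem isPopular_initSeg {α β : ℝ} {c d j : ℕ}
    (hd : ∀ n, condC U (initSeg α n) (initSeg β n) ≤ withheldC U β n + d)
    (hc : 2 ^ j < 2 * {n ∈ dyadicBlock j | withheldC U β n ≤ c}.card) :
    IsPopular U (c + d) j (initSeg β (2 ^ (j + 1))) (initSeg α j) := by
  refine hc.trans_le (Nat.mul_le_mul_left 2 (Finset.card_le_card fun n hn => ?_))
  obtain ⟨hn, hnc⟩ := Finset.mem_filter.1 hn
  obtain ⟨hjn, hn'⟩ := Finset.mem_Ico.1 hn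
  refine Finset.mem_filter.2
    ⟨hn, initSeg α n, ?_, take_initSeg α (Nat.lt_two_pow_self.le.trans hjn)⟩
  rw [take_initSeg β hn'.le]
  exact (hd n).trans (Nat.add_le_add_right hnc d)

end PopularStrings

section Recognition

theorem getElem?_initSeg_eq_some {α : ℝ} {n i : ℕ} {b : Bool} :
    (initSeg α n)[i]? = some b ↔ i < n ∧ binDigit α i = b := by
  simp only [initSeg, List.getElem?_map, Option.map_eq_some_iff, List.getElem?_eq_some_iff,
    List.length_range, List.getElem_range, exists_prop]
  grind

theorem computableFrom_of_recognized {α β : ℝ} {P : List Bool → List Bool → Prop}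
    (hP : REPred fun a : List Bool × List Bool => P a.1 a.2)
    (sound : ∀ n x, P (initSeg β n) x → x = initSeg α x.length)
    (complete : ∀ i, ∃ n m, i < m ∧ P (initSeg β n) (initSeg α m)) : ComputableFrom α β := by
  have index : Computable fun c : (ℕ × Bool × List Bool) × List Bool => c.1.1 :=
    Computable.fst.comp Computable.fst
  have bit_and_prefix : Computable fun c : (ℕ × Bool × List Bool) × List Bool => c.1.2 :=
    Computable.snd.comp Computable.fst
  have recognized : REPred fun c : (ℕ × Bool × List Bool) × List Bool => P c.1.2.2 c.2 :=
    rePred_comp hP ((Computable.snd.comp bit_and_prefix).pair Computable.snd)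
  have digit : REPred fun c : (ℕ × Bool × List Bool) × List Bool => c.2[c.1.1]? = some c.1.2.1 :=
    rePred_eq (Computable.list_getElem?.comp Computable.snd index)
      (Computable.option_some.comp (Computable.fst.comp bit_and_prefix))
  refine turingReducible_of_rePred_prefix (R := fun i b y => ∃ x, P y x ∧ x[i]? = some b)
    (rePred_exists (p := fun (a : ℕ × Bool × List Bool) x => P a.2.2 x ∧ x[a.1]? = some a.2.1)
      (rePred_and recognized digit)) ?_ fun i => ?_
  · rintro i b n ⟨x, hx, hb⟩
    rw [sound n x hx] at hb
    exact (getElem?_initSeg_eq_some.1 hb).2.symm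
  · obtain ⟨n, m, him, hP⟩ := complete i
    exact ⟨binDigit α i, n, initSeg α m, hP, getElem?_initSeg_eq_some.2 ⟨him, rfl⟩⟩

end Recognition

section PopularRank

variable {U : List Bool → List Bool →. List Bool}

open scoped Classical in
/-- The number of popular strings among those with code at most `v`. -/
noncomputable def popularRank (U : List Bool → List Bool →. List Bool) (e j : ℕ) (y : List Bool)
    (v : ℕ) : ℕ :=
  {w ∈ Finset.range (v + 1) | IsPopular U e j y (natStr w)}.card

theorem eq_of_popularRank_le {e j v w : ℕ} {y : List Bool} (hw : IsPopular U e j y (natStr w))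
    (hvw : v ≤ w) (h : popularRank U e j y w ≤ popularRank U e j y v) : v = w := by
  classical
  by_contra hne
  refine h.not_gt (Finset.card_lt_card (Finset.ssubset_iff_of_subset ?_ |>.2 ⟨w, ?_, ?_⟩))
  · exact Finset.filter_subset_filter _ (Finset.range_subset_range.2 (Nat.succ_le_succ hvw))
  · exact Finset.mem_filter.2 ⟨Finset.self_mem_range_succ w, hw⟩
  · simp only [Finset.mem_filter, Finset.mem_range]
    omega

namespace IsAdditivelyOptimal

theorem popularRank_le (hU : IsAdditivelyOptimal U) (e j : ℕ) (y : List Bool) (v : ℕ) :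
    popularRank U e j y v ≤ 2 ^ (e + 2) := by
  classical
  rw [popularRank, ← Finset.card_image_of_injective _
    (Function.LeftInverse.injective strNat_natStr)]
  refine hU.card_isPopular_le (j := j) (y := y) fun x hx => ?_
  obtain ⟨w, hw, rfl⟩ := Finset.mem_image.1 hx
  exact (Finset.mem_filter.1 hw).2

theorem rePred_le_popularRank (hU : IsAdditivelyOptimal U) (hU' : Partrec₂ U) (e l : ℕ) {γ : Type*}
    [Primcodable γ] {j v : γ → ℕ} {y : γ → List Bool} (hj : Computable j) (hy : Computable y)
    (hv : Computable v) : REPred fun a => l ≤ popularRank U e (j a) (y a) (v a) :=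
  rePred_le_card_filter (p := fun a w => IsPopular U e (j a) (y a) (natStr w))
    (rePred_comp (hU.rePred_isPopular hU' e) ((hj.comp Computable.fst).pair
      ((hy.comp Computable.fst).pair (computable_natStr.comp Computable.snd))))
    (Computable.const l) (Computable.succ.comp hv)

end IsAdditivelyOptimal

theorem exists_eventually_le_frequently_ge {ι : Type*} {F : Filter ι} [F.NeBot] {f : ι → ℕ} {b : ℕ}
    (hf : ∀ i, f i ≤ b) : ∃ l, (∀ᶠ i in F, f i ≤ l) ∧ ∃ᶠ i in F, l ≤ f i := by
  classical
  have bounded : ∃ l, ∀ᶠ i in F, f i ≤ l := ⟨b, .of_forall hf⟩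
  refine ⟨Nat.find bounded, Nat.find_spec bounded, fun h => ?_⟩
  obtain ⟨i, hi⟩ := h.exists
  refine Nat.find_min bounded (m := Nat.find bounded - 1) (by omega) ?_
  filter_upwards [h] with i hi
  omega

/-- The criterion by which a prefix `y` of `β` recognises an initial segment `x` of `α`: at some
level `j ≥ j₀` the guess `g j` is `y`, and the approximation `A` takes the value `x`, up to which
there are at least `l` popular strings. -/
def ReachesRank (U : List Bool → List Bool →. List Bool) (A : ℕ → ℕ → List Bool)
    (g : ℕ →. List Bool) (e l j₀ : ℕ) (y x : List Bool) : Prop :=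
  ∃ t : ℕ × ℕ, (j₀ ≤ t.1 ∧ y.length = 2 ^ (t.1 + 1)) ∧ (y ∈ g t.1 ∧ A t.2 t.1 = x) ∧
    l ≤ popularRank U e t.1 y (strNat x)

theorem IsAdditivelyOptimal.rePred_reachesRank (hU : IsAdditivelyOptimal U) (hU' : Partrec₂ U)
    {A : ℕ → ℕ → List Bool} (hA : Computable₂ A) {g : ℕ →. List Bool} (hg : Partrec g)
    (e l j₀ : ℕ) :
    REPred fun a : List Bool × List Bool => ReachesRank U A g e l j₀ a.1 a.2 := by
  have prefix_y : Computable fun c : (List Bool × List Bool) × ℕ × ℕ => c.1.1 :=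
    Computable.fst.comp Computable.fst
  have string_x : Computable fun c : (List Bool × List Bool) × ℕ × ℕ => c.1.2 :=
    Computable.snd.comp Computable.fst
  have level : Computable fun c : (List Bool × List Bool) × ℕ × ℕ => c.2.1 :=
    Computable.fst.comp Computable.snd
  have long_enough := rePred_and (rePred_le (Computable.const j₀) level)
    (rePred_eq (Computable.list_length.comp prefix_y)
      (primrec_two_pow.to_comp.comp (Computable.succ.comp level)))
  have guessed := rePred_and (rePred_mem (hg.comp level) prefix_y)
    (rePred_eq (hA.comp (Computable.snd.comp Computable.snd) level) string_x)
  have ranked := hU.rePred_le_popularRank hU' e l level prefix_y (computable_strNat.comp string_x)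
  exact rePred_exists (p := fun (a : List Bool × List Bool) (t : ℕ × ℕ) =>
    (j₀ ≤ t.1 ∧ a.1.length = 2 ^ (t.1 + 1)) ∧ (a.1 ∈ g t.1 ∧ A t.2 t.1 = a.2) ∧
      l ≤ popularRank U e t.1 a.1 (strNat a.2)) (rePred_and long_enough (rePred_and guessed ranked))

theorem computableFrom_of_frequently_mem (hU : IsAdditivelyOptimal U) (hU' : Partrec₂ U)
    {α β : ℝ} {A : ℕ → ℕ → List Bool} (hA : IsLeftApprox A α) {g : ℕ →. List Bool} (hg : Partrec g)
    (hgβ : ∃ᶠ j in Filter.atTop, initSeg β (2 ^ (j + 1)) ∈ g j) {e : ℕ}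
    (popular : ∀ j, initSeg β (2 ^ (j + 1)) ∈ g j →
      IsPopular U e j (initSeg β (2 ^ (j + 1))) (initSeg α j)) : ComputableFrom α β := by
  let guessed : Set ℕ := {j | initSeg β (2 ^ (j + 1)) ∈ g j}
  let rank (j : ℕ) : ℕ := popularRank U e j (initSeg β (2 ^ (j + 1))) (strNat (initSeg α j))
  have : (Filter.atTop ⊓ Filter.principal guessed).NeBot := Filter.frequently_mem_iff_neBot.1 hgβ
  -- `l` is the limit superior of `rank` over the guessed levels.
  obtain ⟨l, eventually_le, frequently_ge⟩ := exists_eventually_le_frequently_ge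
    (F := Filter.atTop ⊓ Filter.principal guessed) (f := rank) fun j => hU.popularRank_le e j _ _
  obtain ⟨j₀, rank_le⟩ :=
    Filter.eventually_atTop.1 (Filter.eventually_inf_principal.1 eventually_le)
  refine computableFrom_of_recognized (hU.rePred_reachesRank hU' hA.computable hg e l j₀) ?_
    fun i => ?_
  · rintro n x ⟨⟨j, s⟩, ⟨hj, hn⟩, ⟨hmem, rfl⟩, hl⟩
    obtain rfl : n = 2 ^ (j + 1) := (length_initSeg β n).symm.trans hn
    have code_eq : strNat (A s j) = strNat (initSeg α j) :=
      eq_of_popularRank_le ((natStr_strNat _).symm ▸ popular j hmem) (hA.le s j)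
        ((rank_le j hj hmem).trans hl)
    rw [strNat_injective code_eq, length_initSeg]
  · obtain ⟨j, ⟨hmem, hl⟩, hj⟩ := ((Filter.frequently_inf_principal.1 frequently_ge).and_eventually
      (Filter.eventually_ge_atTop (max j₀ (i + 1)))).exists
    obtain ⟨s, hs⟩ := (hA.eventually_eq j).exists
    exact ⟨2 ^ (j + 1), j, by omega, (j, s), ⟨by omega, length_initSeg _ _⟩, ⟨hmem, hs⟩, hl⟩

end PopularRank

section LateChanges

/-- The first stage from `s` on at which the approximation to the first `n` digits differs from
its value at stage `s`. -/
def firstChange (A : ℕ → ℕ → List Bool) (n s : ℕ) : Part ℕ :=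
  Nat.rfind fun t => Part.some (decide (s ≤ t ∧ A t n ≠ A s n))

/-- The approximation `B` to the first `2 ^ (j + 1)` digits of `β` at the stage of the change of
`A` that is coded by `j`. -/
def lateChangeGuess (A B : ℕ → ℕ → List Bool) (j : ℕ) : Part (List Bool) :=
  (firstChange A j.unpair.1 j.unpair.2).map fun t => B t (2 ^ (j + 1))

theorem partrec_lateChangeGuess {A B : ℕ → ℕ → List Bool} (hA : Computable₂ A)
    (hB : Computable₂ B) : Partrec (lateChangeGuess A B) := by
  have length : Computable fun c : ℕ × ℕ => c.1.unpair.1 :=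
    Computable.fst.comp (Computable.unpair.comp Computable.fst)
  have stage : Computable fun c : ℕ × ℕ => c.1.unpair.2 :=
    Computable.snd.comp (Computable.unpair.comp Computable.fst)
  have and_not : Computable₂ fun a b : Bool => a && !b :=
    (Primrec.and.comp Primrec.fst (Primrec.not.comp Primrec.snd)).to_comp
  have le : Computable₂ fun m n : ℕ => decide (m ≤ n) := Primrec.nat_le.decide.to_comp
  have eq : Computable₂ fun x y : List Bool => decide (x = y) := Primrec.eq.decide.to_comp
  have changed : Computable₂ fun j t : ℕ =>
      decide (j.unpair.2 ≤ t ∧ A t j.unpair.1 ≠ A j.unpair.2 j.unpair.1) :=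
    (and_not.comp (le.comp stage Computable.snd)
      (eq.comp (hA.comp Computable.snd length) (hA.comp stage length))).of_eq
        fun c => by simp [Bool.decide_and]
  exact (Partrec.rfind changed.partrec₂).map (hB.comp Computable.snd
    (primrec_two_pow.to_comp.comp (Computable.succ.comp Computable.fst))).to₂

/-- The criterion by which a prefix `y` of `β` recognises an initial segment `x` of `α`: `A` has
the value `x` at a stage `s₀`, and still at a stage at which `B` has the value `y`; the length of
`y` is the one guessed from the first change of `A` after `s₀`. -/
def OutlastsChanges (A B : ℕ → ℕ → List Bool) (j₀ : ℕ) (y x : List Bool) : Prop :=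
  ∃ t : ℕ × ℕ, (j₀ ≤ Nat.pair x.length t.1 ∧ y.length = 2 ^ (Nat.pair x.length t.1 + 1)) ∧
    B t.2 y.length = y ∧ A t.1 x.length = x ∧ A t.2 x.length = x

theorem rePred_outlastsChanges {A B : ℕ → ℕ → List Bool} (hA : Computable₂ A) (hB : Computable₂ B)
    (j₀ : ℕ) : REPred fun a : List Bool × List Bool => OutlastsChanges A B j₀ a.1 a.2 := by
  have prefix_y : Computable fun c : (List Bool × List Bool) × ℕ × ℕ => c.1.1 :=
    Computable.fst.comp Computable.fst
  have string_x : Computable fun c : (List Bool × List Bool) × ℕ × ℕ => c.1.2 :=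
    Computable.snd.comp Computable.fst
  have stage : Computable fun c : (List Bool × List Bool) × ℕ × ℕ => c.2.1 :=
    Computable.fst.comp Computable.snd
  have late_stage : Computable fun c : (List Bool × List Bool) × ℕ × ℕ => c.2.2 :=
    Computable.snd.comp Computable.snd
  have length_y := Computable.list_length.comp prefix_y
  have length_x := Computable.list_length.comp string_x
  have level : Computable fun c : (List Bool × List Bool) × ℕ × ℕ =>
      Nat.pair c.1.2.length c.2.1 :=
    Primrec₂.natPair.to_comp.comp length_x stage
  have long_enough := rePred_and (rePred_le (Computable.const j₀) level)
    (rePred_eq length_y (primrec_two_pow.to_comp.comp (Computable.succ.comp level)))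
  have settled := rePred_and (rePred_eq (hB.comp late_stage length_y) prefix_y)
    (rePred_and (rePred_eq (hA.comp stage length_x) string_x)
      (rePred_eq (hA.comp late_stage length_x) string_x))
  exact rePred_exists (p := fun (a : List Bool × List Bool) (t : ℕ × ℕ) =>
    (j₀ ≤ Nat.pair a.2.length t.1 ∧ a.1.length = 2 ^ (Nat.pair a.2.length t.1 + 1)) ∧
        B t.2 a.1.length = a.1 ∧ A t.1 a.2.length = a.2 ∧ A t.2 a.2.length = a.2)
    (rePred_and long_enough settled)

variable {A B : ℕ → ℕ → List Bool} {α β : ℝ}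

theorem IsLeftApprox.exists_mem_firstChange (hA : IsLeftApprox A α) {n s₀ s : ℕ}
    (h : A s n = A s₀ n) (hne : A s₀ n ≠ initSeg α n) : ∃ t ≥ s, t ∈ firstChange A n s₀ := by
  obtain ⟨r, hr, hrs⟩ := ((hA.eventually_eq n).and (Filter.eventually_ge_atTop s₀)).exists
  obtain ⟨t, ht, -⟩ := Nat.rfind_min' (p := fun t => decide (s₀ ≤ t ∧ A t n ≠ A s₀ n)) (m := r)
    (decide_eq_true ⟨hrs, fun h => hne (h.symm.trans hr)⟩)
  obtain ⟨hs₀t, hchange⟩ := of_decide_eq_true (Part.mem_some_iff.1 (Nat.rfind_spec ht)).symm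
  refine ⟨t, ?_, ht⟩
  by_contra! hts
  exact hchange (strNat_injective (le_antisymm (h ▸ hA.mono n hts.le) (hA.mono n hs₀t)))

theorem IsLeftApprox.computableFrom_of_eventually_notMem (hA : IsLeftApprox A α)
    (hB : IsLeftApprox B β)
    (h : ∀ᶠ j in Filter.atTop, initSeg β (2 ^ (j + 1)) ∉ lateChangeGuess A B j) :
    ComputableFrom α β := by
  obtain ⟨j₀, hj₀⟩ := Filter.eventually_atTop.1 h
  refine computableFrom_of_recognized
    (rePred_outlastsChanges hA.computable hB.computable j₀) ?_ fun i => ?_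
  · rintro n x ⟨⟨s₀, s⟩, ⟨hj, hn⟩, hBs, hs₀x, hsx⟩
    rw [length_initSeg] at hn hBs
    by_contra hne
    obtain ⟨t, hst, ht⟩ := hA.exists_mem_firstChange (hsx.trans hs₀x.symm)
      (fun h => hne (hs₀x.symm.trans h))
    refine hj₀ _ hj ((Part.mem_map_iff _).2 ⟨t, ?_, ?_⟩)
    · rwa [Nat.unpair_pair]
    · exact hn ▸ hB.eq_of_le hBs hst
  · obtain ⟨s₀, hs₀, hj₀s₀⟩ := ((hA.eventually_eq (i + 1)).and
      (Filter.eventually_ge_atTop j₀)).exists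
    let n := 2 ^ (Nat.pair (i + 1) s₀ + 1)
    obtain ⟨s, hs, hs₀s⟩ := ((hB.eventually_eq n).and (Filter.eventually_ge_atTop s₀)).exists
    refine ⟨n, i + 1, Nat.lt_succ_self i, (s₀, s), ?_⟩
    simp only [length_initSeg]
    exact ⟨⟨hj₀s₀.trans (Nat.right_le_pair _ _), rfl⟩, hs, hs₀, hA.eq_of_le hs₀ hs₀s⟩

end LateChanges

theorem mainTheorem9_general {U : List Bool → List Bool →. List Bool} (hU' : Partrec₂ U)
    (hU : IsAdditivelyOptimal U) {α β : ℝ} (hα : IsLeftCE α) (hβ : IsLeftCE β) {d : ℕ}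
    (hd : ∀ n, condC U (initSeg α n) (initSeg β n) ≤ withheldC U β n + d) :
    ComputableFrom α β := by
  obtain ⟨A, hA⟩ := hα.exists_isLeftApprox
  obtain ⟨B, hB⟩ := hβ.exists_isLeftApprox
  have guess_partrec := partrec_lateChangeGuess hA.computable hB.computable
  by_cases guessed : ∃ᶠ j in Filter.atTop, initSeg β (2 ^ (j + 1)) ∈ lateChangeGuess A B j
  · obtain ⟨c, hc⟩ := hU.exists_two_pow_lt_two_mul_card_withheldC_le guess_partrec
    exact computableFrom_of_frequently_mem hU hU' hA guess_partrec guessed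
      fun j hj => isPopular_initSeg hd (hc β j hj)
  · exact hA.computableFrom_of_eventually_notMem hB (Filter.not_frequently.1 guessed)

theorem mainTheorem9 (U : List Bool → List Bool →. List Bool) (hU : IsUniversalOptimal U) :
    (∃ D : ℕ → ℕ → ℕ, Computable₂ D ∧
      ∀ (α β : ℝ) (Pα Pβ : List Bool), IsProgramFor U Pα α → IsProgramFor U Pβ β →
        (∀ n, condC U (initSeg α n) (initSeg β n) ≤
          withheldC U β n + D Pα.length Pβ.length) →
        ComputableFrom α β) ∧
    (∀ α β : ℝ, IsLeftCE α → IsLeftCE β →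
      (∃ d : ℕ, ∀ n, condC U (initSeg α n) (initSeg β n) ≤ withheldC U β n + d) →
      ComputableFrom α β) :=
  ⟨⟨(· + ·), Primrec.nat_add.to_comp, fun _ _ _ _ hα hβ =>
      mainTheorem9_general hU.partrec hU.optimal (hα.isLeftCE hU.partrec)
        (hβ.isLeftCE hU.partrec)⟩,
    fun _ _ hα hβ ⟨_, hd⟩ => mainTheorem9_general hU.partrec hU.optimal hα hβ hd⟩
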